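/- All graphs are finite and simple. A tree decomposition of a graph $G$ is a pair $(T,\beta)$, where $T$ is a tree and $\beta$ assigns to each node of $T$ a set of vertices of $G$, such that for every edge $uv$ of $G$ some node $z$ satisfies $\{u,v\}\subseteq\beta(z)$, and for every vertex $v$ of $G$ the set $\{z : v\in\beta(z)\}$ induces a non-empty connected subtree of $T$. Its width is the maximum of $|\beta(z)|-1$ over all nodes $z$ of $T$, and the tree-width of $G$ is the minimum width of a tree decomposition of $G$. For integers $t\ge 0$ and $k\ge 2$ define $g(t,k)$ recursively by $g(t,2)=g(0,k)=1$ for all $t\ge 0$ and $k\ge 2$, and $$g(t,k)=\left\lceil \frac{t+1}{2}\right\rceil+g\left(\left\lfloor \frac{t-1}{2}\right\rfloor,\,k-1\right)\qquad\text{for } t\ge 1 \text{ and } k\ge 3.$$ **Theorem.** For all integers $t\ge 0$ and $k\ge 2$, there exists a $K_k$-free graph of tree-width at most $t$ with chromatic number at least $g(t,k)$. In particular, for every integer $t\ge 1$ there exists a triangle-free graph of tree-width at most $t$ with chromatic number exactly $\lceil (t+3)/2\rceil$. -/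

import Mathlib

universe u

namespace SimpleGraph

/-- A tree decomposition `(T, β)` of a graph `G`: a tree `T` together with a bag `β z` of vertices
of `G` for every node `z` of `T`, such that both ends of every edge of `G` lie in a common bag, and
for every vertex `v` of `G` the nodes whose bags contain `v` induce a nonempty connected subgraph
of `T`. (`SimpleGraph.Connected` includes nonemptiness.) The tree may be infinite, which matters
only for infinite `G`: for finite `G` it can be cut down to a finite subtree. -/
structure TreeDecomposition {V : Type u} (G : SimpleGraph V) where
  /-- the nodes of the tree -/
  node : Type u
  /-- the tree -/
  tree : SimpleGraph node
  isTree : tree.IsTree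
  /-- the bags -/
  bag : node → Set V
  exists_bag_of_adj : ∀ u v : V, G.Adj u v → ∃ z : node, u ∈ bag z ∧ v ∈ bag z
  connected_of_vertex : ∀ v : V, (tree.induce {z : node | v ∈ bag z}).Connected

/-- The width of a tree decomposition: the maximum of `|β z| - 1` over all nodes `z`
(`⊤` if the bag sizes are unbounded; `0` if all bags are empty). -/
noncomputable def TreeDecomposition.width {V : Type u} {G : SimpleGraph V}
    (D : G.TreeDecomposition) : ℕ∞ :=
  ⨆ z : D.node, ((D.bag z).encard - 1)

/-- The tree-width of a graph: the minimum width of its tree decompositions. -/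
noncomputable def treeWidth {V : Type u} (G : SimpleGraph V) : ℕ∞ :=
  ⨅ D : G.TreeDecomposition, D.width

end SimpleGraph

/-- The function `g(t, k)`, for `t ≥ 0` and `k ≥ 2`: `g(t, 2) = g(0, k) = 1`, and
`g(t, k) = ⌈(t + 1) / 2⌉ + g(⌊(t - 1) / 2⌋, k - 1)` for `t ≥ 1` and `k ≥ 3`.
The values at `k = 0, 1` are irrelevant. Here `⌈/⌉` is division rounding up. -/
def gBound : ℕ → ℕ → ℕ
  | _, 0 => 0
  | _, 1 => 0
  | _, 2 => 1
  | 0, _ + 3 => 1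
  | t + 1, k + 3 => ((t + 1) + 1) ⌈/⌉ 2 + gBound (((t + 1) - 1) / 2) (k + 2)

/-!
The graph is obtained from an infinite universal graph. Its vertices are built along a rooted tree:
a node keeps at most `t` vertices of the bag of its parent and adds itself as a new vertex, joined
to an arbitrary set of kept vertices; all choices occur. So the bags form a tree decomposition of
width at most `t`. Keep only the vertices whose bag contains no `k`-clique. Since a clique lies in
the bag of its last vertex, the remaining graph is `K_k`-free, and it still has the following
extension property: if `P` is part of a bag and `|P| ≤ t`, then for each `A ⊆ P` without
`(k-1)`-clique there is a new vertex whose neighbourhood in `P` is `A`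
(`SimpleGraph.Universal.isExtensionFamily`).

Now fix a proper colouring; the extension property is used to find many colours. Let `R` be a set
that all further vertices are joined to. Suppose that `S` is an independent set with `i` distinct
colours. Add vertices that avoid `S`: if such a vertex `w` has a colour not in `S`, then `S ∪ {w}` is
larger. Otherwise `w` repeats the colour of some `x ∈ S`; then put `w` in the place of `x`, and keep
`x` in the bag, outside `S`, as a forbidder of its colour: later vertices are joined to all such
`x`. After at most `i + 1` steps a new colour must appear
(`SimpleGraph.IsExtensionFamily.exists_rainbow_succ`). Reaching size `⌈(t + 1) / 2⌉` needs only
`2 ⌈(t + 1) / 2⌉ - 1 ≤ t + 1` vertices in a bag besides `R`. Then drop everything except `R ∪ S`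
and continue with `R ∪ S` in the role of `R`. The clique number of the common neighbourhood has to be
smaller by one, because `S` is independent, and there is room for `⌊(t - 1) / 2⌋ + 1` further
vertices in a bag. This gives the recursion of `gBound`
(`SimpleGraph.IsExtensionFamily.exists_rainbow`).

A compactness argument replaces the universal graph by a finite subgraph. For an exact chromatic
number, take the union of the right number of colour classes of an optimal colouring.
-/

namespace SimpleGraph

open Finset

/-! ### Tree-width of subgraphs -/

theorem treeWidth_le_of_injective_hom {V W : Type u} {G : SimpleGraph V} {H : SimpleGraph W}
    (f : H →g G) (hf : Function.Injective f) : H.treeWidth ≤ G.treeWidth := by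
  refine le_iInf fun D => ?_
  let D' : H.TreeDecomposition :=
    { node := D.node
      tree := D.tree
      isTree := D.isTree
      bag := fun z => f ⁻¹' D.bag z
      exists_bag_of_adj := fun u v h => D.exists_bag_of_adj _ _ (f.map_adj h)
      connected_of_vertex := fun v => D.connected_of_vertex (f v) }
  refine (iInf_le _ D').trans (iSup_mono fun z => tsub_le_tsub_right ?_ 1)
  calc (f ⁻¹' D.bag z).encard = (f '' (f ⁻¹' D.bag z)).encard := (hf.encard_image _).symm
    _ ≤ (D.bag z).encard := Set.encard_le_encard (Set.image_preimage_subset _ _)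

/-! ### Chromatic number of subgraphs -/

/-- Compactness: non-colourability of a possibly infinite graph is witnessed by a finite
subgraph. -/
theorem exists_finite_subgraph_not_colorable {V : Type u} {G : SimpleGraph V} {n : ℕ}
    (h : ¬ G.Colorable n) : ∃ G' : G.Subgraph, G'.verts.Finite ∧ ¬ G'.coe.Colorable n := by
  by_contra! hc
  exact h (nonempty_hom_of_forall_finite_subgraph_hom (F := (⊤ : SimpleGraph (Fin n)))
    fun G' hG' => (hc G' hG').some)

/-- The union of `m` colour classes of an optimal colouring has chromatic number exactly `m`. -/
theorem exists_induce_chromaticNumber_eq {V : Type u} [Finite V] (G : SimpleGraph V) {m : ℕ}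
    (h : (m : ℕ∞) ≤ G.chromaticNumber) : ∃ s : Set V, (G.induce s).chromaticNumber = m := by
  obtain ⟨c, hc⟩ := ENat.ne_top_iff_exists.mp
    (chromaticNumber_ne_top_iff_exists.mpr ⟨_, G.colorable_chromaticNumber_of_fintype⟩)
  have hmc : m ≤ c := by rw [← hc] at h; exact_mod_cast h
  obtain ⟨C⟩ : G.Colorable c := chromaticNumber_le_iff_colorable.mp hc.ge
  refine ⟨{v | (C v : ℕ) < m}, le_antisymm ?_ ?_⟩
  · refine chromaticNumber_le_iff_colorable.mpr ⟨Coloring.mk (fun v => ⟨C v.1, v.2⟩) ?_⟩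
    intro u v huv he
    exact C.valid huv (Fin.ext (Fin.mk.inj he))
  · refine le_chromaticNumber_iff_colorable.mpr fun m' ⟨C'⟩ => ?_
    -- recolour the chosen classes by `C'` and keep the other `c - m` classes
    let f : V → Fin m' ⊕ Fin (c - m) := fun v =>
      if hv : (C v : ℕ) < m then .inl (C' ⟨v, hv⟩)
      else .inr ⟨C v - m, by have := (C v).2; omega⟩
    have hf : G.Colorable (m' + (c - m)) := by
      have : G.Coloring (Fin m' ⊕ Fin (c - m)) := Coloring.mk f fun {u v} huv he => by
        by_cases hu : (C u : ℕ) < m <;> by_cases hv : (C v : ℕ) < m <;> simp [f, hu, hv] at he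
        · exact C'.valid (v := ⟨u, hu⟩) (w := ⟨v, hv⟩) huv he
        · exact C.valid huv (Fin.ext (by omega))
      simpa using this.colorable
    have hle := hf.chromaticNumber_le
    rw [← hc] at hle
    have : c ≤ m' + (c - m) := by exact_mod_cast hle
    exact_mod_cast (by omega : m ≤ m')

/-! ### Extension families -/

/-- A family `Pos` of finite vertex sets (thought of as parts of bags of a tree decomposition of
width `t`) such that a member with at most `t` vertices can be enlarged by a vertex with any
prescribed neighbourhood in it that does not create a `k`-clique. -/
structure IsExtensionFamily {V : Type u} [DecidableEq V] (G : SimpleGraph V) (t k : ℕ)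
    (Pos : Set (Finset V)) : Prop where
  empty_mem : ∅ ∈ Pos
  mono : ∀ ⦃P Q : Finset V⦄, P ⊆ Q → Q ∈ Pos → P ∈ Pos
  extend : ∀ P ∈ Pos, #P ≤ t → ∀ A ⊆ P, G.CliqueFreeOn A (k - 1) →
    ∃ w ∉ P, insert w P ∈ Pos ∧ ∀ u ∈ P, G.Adj w u ↔ u ∈ A

theorem IsIndepSet.insert {V : Type u} {G : SimpleGraph V} {s : Set V} {a : V}
    (hs : G.IsIndepSet s) (h : ∀ b ∈ s, ¬ G.Adj a b) : G.IsIndepSet (insert a s) :=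
  Set.Pairwise.insert hs fun b hb _ => ⟨h b hb, fun h' => h b hb h'.symm⟩

theorem CliqueFreeOn.union_isIndepSet {V : Type u} [DecidableEq V] {G : SimpleGraph V}
    {R X : Finset V} {n : ℕ} (hR : G.CliqueFreeOn R n) (hX : G.IsIndepSet X) :
    G.CliqueFreeOn ((R ∪ X : Finset V) : Set V) (n + 1) := by
  intro s hs hc
  have h1 : #(s ∩ X) ≤ 1 := by
    refine card_le_one.mpr fun a ha b hb => ?_
    rw [mem_inter] at ha hb
    by_contra hab
    exact hX ha.2 hb.2 hab (hc.isClique ha.1 hb.1 hab)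
  have h2 := card_sdiff_add_card_inter s X
  rw [hc.card_eq] at h2
  obtain ⟨s', hs', hcard⟩ := exists_subset_card_eq (show n ≤ #(s \ X) by omega)
  refine hR (t := s') (fun a ha => ?_)
    ⟨hc.isClique.subset fun a ha => (mem_sdiff.mp (hs' ha)).1, hcard⟩
  have h3 := mem_sdiff.mp (hs' ha)
  exact (mem_union.mp (hs h3.1)).resolve_right h3.2

/-- One vertex more for a rainbow independent set. The set `X` consists of former members of `S`;
each has been replaced in `S` by a later vertex of the same colour, so that the neighbourhoods of
new vertices can use the colours of `X` without touching `S`. A new vertex with neighbourhood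
`R ∪ X` either has a colour not in `S`, and then enlarges `S`, or it replaces a vertex of `S`, which
moves to `X`. When `X` has all colours of `S`, the first case must occur. The induction is on
`n = |S| - |X|`. A vertex that replaces another one has its colour in `X` from then on, so a vertex
of `S` whose colour is missing in `X` has been in `S` all the time and has no neighbour in `X`. -/
theorem IsExtensionFamily.exists_rainbow_succ {V : Type u} [DecidableEq V] {α : Type*}
    {G : SimpleGraph V} {T K : ℕ} {Pos : Set (Finset V)} (hPos : G.IsExtensionFamily T K Pos)
    (C : G.Coloring α) {R : Finset V} {r i : ℕ} (hR : G.CliqueFreeOn R (r + 1)) (hr : r + 3 ≤ K)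
    (hi : #R + 2 * i ≤ T) (n : ℕ) (S X : Finset V) (hmem : R ∪ S ∪ X ∈ Pos)
    (hSR : ∀ a ∈ S, ∀ b ∈ R, G.Adj a b) (hXR : ∀ a ∈ X, ∀ b ∈ R, G.Adj a b)
    (hS : #S = i) (hX : #X + n = i) (hdisj : Disjoint S X)
    (hSi : G.IsIndepSet S) (hXi : G.IsIndepSet X)
    (hSC : Set.InjOn C S) (hXC : Set.InjOn C X) (hXS : C '' X ⊆ C '' S)
    (hSX : ∀ a ∈ S, C a ∉ C '' X → ∀ x ∈ X, ¬ G.Adj a x) :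
    ∃ S' : Finset V, R ∪ S' ∈ Pos ∧ (∀ a ∈ S', ∀ b ∈ R, G.Adj a b) ∧ #S' = i + 1 ∧
      G.IsIndepSet S' ∧ Set.InjOn C S' := by
  classical
  induction n using Nat.strong_induction_on generalizing S X with
  | _ n ih =>
    have hcard : #(R ∪ S ∪ X) ≤ T := by
      have h1 := card_union_le (R ∪ S) X
      have h2 := card_union_le R S
      omega
    obtain ⟨w, hwP, hwmem, hw⟩ := hPos.extend _ hmem hcard (R ∪ X)
      (union_subset_union_left subset_union_left)
      (CliqueFreeOn.mono G (by omega) (hR.union_isIndepSet hXi))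
    have hwR : ∀ b ∈ R, G.Adj w b := fun b hb => (hw b (by simp [hb])).mpr (by simp [hb])
    have hwX : ∀ b ∈ X, G.Adj w b := fun b hb => (hw b (by simp [hb])).mpr (by simp [hb])
    have hwS : ∀ a ∈ S, ¬ G.Adj w a := fun a ha h => by
      rcases mem_union.mp ((hw a (by simp [ha])).mp h) with haR | h
      · exact G.loopless.irrefl a (hSR a ha a haR)
      · exact Finset.disjoint_left.mp hdisj ha h
    have hwC : C w ∉ C '' X := by
      rintro ⟨x, hx, he⟩
      exact C.valid (hwX x hx) he.symm
    by_cases hnew : C w ∈ C '' S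
    · obtain ⟨x, hxS, hxw⟩ := hnew
      have hxS : x ∈ S := hxS
      have hxC : C x ∉ C '' X := hxw ▸ hwC
      have hxX : x ∉ X := fun h => hxC ⟨x, h, rfl⟩
      have hwS' : w ∉ S.erase x := fun h =>
        (mem_erase.mp h).1 (hSC (mem_of_mem_erase h) hxS hxw.symm)
      have hn : #X < #S := by
        rw [← card_image_of_injOn hSC, ← card_image_of_injOn hXC]
        refine card_lt_card ((ssubset_iff_of_subset ?_).mpr ⟨C x, mem_image_of_mem _ hxS, ?_⟩)
        · exact_mod_cast hXS
        · simpa using hxC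
      refine ih (n - 1) (by omega) (insert w (S.erase x)) (insert x X) ?_ ?_ ?_ ?_ ?_ ?_ ?_
        ?_ ?_ ?_ ?_ ?_
      · refine hPos.mono (fun a ha => ?_) hwmem
        simp only [mem_union, mem_insert, mem_erase] at ha ⊢
        rcases ha with (ha | ha | ha) | ha | ha
        · exact .inr (.inl (.inl ha))
        · exact .inl ha
        · exact .inr (.inl (.inr ha.2))
        · exact .inr (.inl (.inr (ha ▸ hxS)))
        · exact .inr (.inr ha)
      · intro a ha b hb
        rcases mem_insert.mp ha with rfl | ha
        · exact hwR b hb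
        · exact hSR a (mem_of_mem_erase ha) b hb
      · intro a ha b hb
        rcases mem_insert.mp ha with rfl | ha
        · exact hSR a hxS b hb
        · exact hXR a ha b hb
      · rw [card_insert_of_notMem hwS', card_erase_of_mem hxS]
        omega
      · rw [card_insert_of_notMem hxX]
        omega
      · rw [disjoint_insert_left, disjoint_insert_right, mem_insert, not_or]
        refine ⟨⟨fun h => hwP ?_, fun h => hwP ?_⟩, notMem_erase x S,
          hdisj.mono_left (erase_subset x S)⟩
        · simp [h, hxS]
        · simp [h]
      · rw [coe_insert]
        refine IsIndepSet.insert (hSi.mono (coe_subset.mpr (erase_subset x S))) fun a ha => ?_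
        exact hwS a (mem_of_mem_erase (mem_coe.mp ha))
      · rw [coe_insert]
        exact IsIndepSet.insert hXi (hSX x hxS hxC)
      · rw [coe_insert, Set.injOn_insert (by exact_mod_cast hwS')]
        refine ⟨hSC.mono (coe_subset.mpr (erase_subset x S)), ?_⟩
        rintro ⟨a, ha, he⟩
        have ha := mem_erase.mp (mem_coe.mp ha)
        exact ha.1 (hSC ha.2 hxS (he.trans hxw.symm))
      · rw [coe_insert, Set.injOn_insert (by exact_mod_cast hxX)]
        exact ⟨hXC, hxC⟩
      · have hsub : C '' S ⊆ C '' (insert w (S.erase x) : Finset V) := by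
          rintro _ ⟨a, ha, rfl⟩
          by_cases hax : a = x
          · exact ⟨w, by simp, by rw [hax, hxw]⟩
          · exact ⟨a, by simp [hax, mem_coe.mp ha], rfl⟩
        rw [coe_insert, Set.image_insert_eq]
        exact Set.insert_subset (hsub ⟨x, hxS, rfl⟩) (hXS.trans hsub)
      · intro a ha haC y hy
        rw [coe_insert, Set.image_insert_eq, Set.mem_insert_iff, not_or] at haC
        rcases mem_insert.mp ha with rfl | ha
        · exact absurd hxw.symm haC.1
        have ha := mem_erase.mp ha
        rcases mem_insert.mp hy with rfl | hy
        · exact hSi ha.2 hxS ha.1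
        · exact hSX a ha.2 haC.2 y hy
    · have hwS' : w ∉ S := fun h => hnew ⟨w, h, rfl⟩
      refine ⟨insert w S, hPos.mono (fun a ha => ?_) hwmem, fun a ha b hb => ?_, ?_, ?_, ?_⟩
      · simp only [mem_union, mem_insert] at ha ⊢
        rcases ha with ha | ha | ha
        · exact .inr (.inl (.inl ha))
        · exact .inl ha
        · exact .inr (.inl (.inr ha))
      · rcases mem_insert.mp ha with rfl | ha
        · exact hwR b hb
        · exact hSR a ha b hb
      · rw [card_insert_of_notMem hwS', hS]
      · rw [coe_insert]
        exact IsIndepSet.insert hSi hwS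
      · rw [coe_insert, Set.injOn_insert (by exact_mod_cast hwS')]
        exact ⟨hSC, hnew⟩

theorem IsExtensionFamily.exists_common_neighbor {V : Type u} [DecidableEq V] {G : SimpleGraph V}
    {T K : ℕ} {Pos : Set (Finset V)} (hPos : G.IsExtensionFamily T K Pos) {R : Finset V}
    (hmem : R ∈ Pos) (hT : #R ≤ T) (hR : G.CliqueFreeOn R (K - 1)) :
    ∃ w, ∀ b ∈ R, G.Adj w b := by
  obtain ⟨w, -, -, hw⟩ := hPos.extend R hmem hT R subset_rfl hR
  exact ⟨w, fun b hb => (hw b hb).mpr hb⟩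

/-- Every colouring shows `gBound t k` colours on common neighbours of `R`, provided that `R`
leaves room for `t + 1` further vertices in a bag, and that `K_{r+1}`-freeness of `R` allows
`(k-1)`-cliques in the common neighbourhood. -/
theorem IsExtensionFamily.exists_rainbow {V : Type u} [DecidableEq V] {α : Type*}
    {G : SimpleGraph V} {T K : ℕ} {Pos : Set (Finset V)} (hPos : G.IsExtensionFamily T K Pos)
    (C : G.Coloring α) {k : ℕ} (hk : 2 ≤ k) {t r : ℕ} {R : Finset V} (hmem : R ∈ Pos)
    (hT : #R + t ≤ T) (hK : k + r ≤ K) (hR : G.CliqueFreeOn R (r + 1)) :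
    ∃ Q : Finset V, (∀ a ∈ Q, ∀ b ∈ R, G.Adj a b) ∧ Set.InjOn C Q ∧ gBound t k ≤ #Q := by
  classical
  have base : ∀ R ∈ Pos, #R ≤ T → G.CliqueFreeOn R (K - 1) →
      ∃ Q : Finset V, (∀ a ∈ Q, ∀ b ∈ R, G.Adj a b) ∧ Set.InjOn C Q ∧ 1 ≤ #Q := by
    intro R hmem hT hR
    obtain ⟨w, hw⟩ := hPos.exists_common_neighbor hmem hT hR
    exact ⟨{w}, by simpa using hw, by simp, by simp⟩
  induction k, hk using Nat.le_induction generalizing t r R with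
  | base => simpa [gBound] using base R hmem (by omega) (CliqueFreeOn.mono G (by omega) hR)
  | succ k hk ih =>
    obtain ⟨k, rfl⟩ := Nat.exists_eq_add_of_le' hk
    rcases t with _ | t
    · simpa [gBound] using base R hmem (by omega) (CliqueFreeOn.mono G (by omega) hR)
    have hs : ∀ i ≤ (t + 2) ⌈/⌉ 2, ∃ S : Finset V, R ∪ S ∈ Pos ∧
        (∀ a ∈ S, ∀ b ∈ R, G.Adj a b) ∧ #S = i ∧ G.IsIndepSet S ∧ Set.InjOn C S := by
      intro i hi
      rw [Nat.ceilDiv_eq_add_pred_div] at hi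
      induction i with
      | zero => exact ⟨∅, by simpa using hmem, by simp, by simp, by simp, by simp⟩
      | succ i ihi =>
        obtain ⟨S, h1, h2, h3, h4, h5⟩ := ihi (by omega)
        exact hPos.exists_rainbow_succ C hR (by omega) (by omega) i S ∅ (by simpa using h1) h2
          (by simp) h3 (by simp) (by simp) h4 (by simp) h5 (by simp) (by simp) (by simp)
    obtain ⟨S, hSmem, hSR, hScard, hSi, hSC⟩ := hs _ le_rfl
    have hceil : (t + 2) ⌈/⌉ 2 = (t + 3) / 2 := by rw [Nat.ceilDiv_eq_add_pred_div]; rfl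
    have hR' := hR.union_isIndepSet hSi
    have hcard := card_union_le R S
    have hT' : #(R ∪ S) + t / 2 ≤ T := by omega
    obtain ⟨Q, hQ, hQC, hQg⟩ := ih (t := t / 2) (r := r + 1) hSmem hT' (by omega) hR'
    have hne : ∀ a ∈ S, ∀ b ∈ Q, C a ≠ C b := fun a ha b hb =>
      (C.valid (hQ b hb a (mem_union_right _ ha))).symm
    have hdisj : Disjoint S Q := Finset.disjoint_left.mpr fun a ha hb => hne a ha a hb rfl
    refine ⟨S ∪ Q, ?_, ?_, ?_⟩
    · intro a ha b hb
      rcases mem_union.mp ha with ha | ha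
      · exact hSR a ha b hb
      · exact hQ a ha b (mem_union_left _ hb)
    · rw [coe_union, Set.injOn_union (by exact_mod_cast hdisj)]
      exact ⟨hSC, hQC, fun a ha b hb => hne a (mem_coe.mp ha) b (mem_coe.mp hb)⟩
    · rw [card_union_of_disjoint hdisj, hScard]
      simpa [gBound] using hQg

/-! ### The universal graph -/

namespace Universal

/-- A node of the universal tree: a sequence of moves, latest first, so that the tail of a node is
its parent. In a move `(K, A)` the sets `K` and `A` are the levels of those vertices of the current
bag that stay in the bag and that are joined to the new vertex, respectively. Every node is also a
vertex of the universal graph, and its level is its length. -/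
abbrev Node : Type := List (Finset ℕ × Finset ℕ)

/-- The bag of a node: the node itself, and the part of the bag of its parent that is kept. A move
that would keep more than `t` vertices keeps none. -/
def bag (t : ℕ) : Node → Finset Node
  | [] => {[]}
  | m :: z =>
    insert (m :: z)
      (if #{u ∈ bag t z | u.length ∈ m.1} ≤ t then {u ∈ bag t z | u.length ∈ m.1} else ∅)

/-- The neighbours of a vertex of smaller level. -/
def lower (t : ℕ) : Node → Finset Node
  | [] => ∅
  | m :: z => {u ∈ (bag t (m :: z)).erase (m :: z) | u.length ∈ m.2}

variable {t k : ℕ}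

theorem suffix_of_mem_bag {u z : Node} (h : u ∈ bag t z) : u <:+ z := by
  induction z with
  | nil => simpa [bag] using h
  | cons m z ih =>
    rw [bag, mem_insert] at h
    rcases h with rfl | h
    · exact List.suffix_rfl
    · split_ifs at h
      · exact (ih (mem_filter.mp h).1).trans (List.suffix_cons m z)
      · simp at h

theorem self_mem_bag (z : Node) : z ∈ bag t z := by
  cases z <;> simp [bag]

theorem card_bag_le (z : Node) : #(bag t z) ≤ t + 1 := by
  cases z with
  | nil => simp [bag]
  | cons m z =>
    rw [bag]
    refine (card_insert_le _ _).trans (Nat.succ_le_succ ?_)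
    split_ifs with h
    · exact h
    · simp

theorem mem_bag_of_mem_bag_cons {u z : Node} {m : Finset ℕ × Finset ℕ}
    (h : u ∈ bag t (m :: z)) (hne : u ≠ m :: z) : u ∈ bag t z := by
  rw [bag, mem_insert] at h
  have h := h.resolve_left hne
  split_ifs at h
  · exact (mem_filter.mp h).1
  · simp at h

theorem length_injOn_bag (z : Node) : Set.InjOn List.length (bag t z : Set Node) := by
  intro u hu v hv h
  exact List.IsSuffix.eq_of_length
    (List.suffix_of_suffix_length_le (suffix_of_mem_bag hu) (suffix_of_mem_bag hv) h.le) h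

theorem lower_subset_bag (z : Node) : lower t z ⊆ bag t z := by
  cases z with
  | nil => simp [lower]
  | cons m z => exact (filter_subset _ _).trans (erase_subset _ _)

theorem length_lt_of_mem_lower {u z : Node} (h : u ∈ lower t z) : u.length < z.length := by
  have hs := suffix_of_mem_bag (lower_subset_bag z h)
  refine lt_of_le_of_ne hs.length_le fun he => ?_
  obtain rfl := hs.eq_of_length he
  cases u <;> simp [lower] at h

/-- The graph on all nodes in which every vertex `v` is joined to `lower t v`. -/
def graph (t : ℕ) : SimpleGraph Node where
  Adj u v := u ∈ lower t v ∨ v ∈ lower t u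
  symm := ⟨fun _ _ h => h.symm⟩
  loopless := ⟨fun _ h => lt_irrefl _ (length_lt_of_mem_lower (or_self_iff.mp h))⟩

theorem adj_iff_of_length_lt {u v : Node} (h : u.length < v.length) :
    (graph t).Adj u v ↔ u ∈ lower t v :=
  or_iff_left fun h' => lt_asymm h (length_lt_of_mem_lower h')

/-- Any move from `z` with at most `t` kept vertices is available. -/
theorem exists_cons {z : Node} {P A : Finset Node} (hP : P ⊆ bag t z) (hcard : #P ≤ t)
    (hA : A ⊆ P) : ∃ m, bag t (m :: z) = insert (m :: z) P ∧ lower t (m :: z) = A := by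
  have key : ∀ B ⊆ bag t z, ∀ D ⊆ bag t z, B ⊆ D →
      {u ∈ D | u.length ∈ B.image List.length} = B := by
    intro B hB D hD hBD
    ext u
    simp only [mem_filter, mem_image]
    refine ⟨fun ⟨hu, v, hv, he⟩ => ?_, fun hu => ⟨hBD hu, u, hu, rfl⟩⟩
    rwa [← length_injOn_bag z (hB hv) (hD hu) he]
  refine ⟨(P.image List.length, A.image List.length), ?_⟩
  have hbag : bag t ((P.image List.length, A.image List.length) :: z) =
      insert ((P.image List.length, A.image List.length) :: z) P := by
    rw [bag, key P hP _ subset_rfl hP, if_pos hcard]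
  refine ⟨hbag, ?_⟩
  have hnot : (P.image List.length, A.image List.length) :: z ∉ P := fun h => by
    simpa using (suffix_of_mem_bag (hP h)).length_le
  rw [lower, hbag, erase_insert hnot]
  exact key A (hA.trans hP) P hP hA

/-- The tree on all nodes in which `z` is the parent of `m :: z`. -/
def tree : SimpleGraph Node where
  Adj u v := (∃ m, v = m :: u) ∨ ∃ m, u = m :: v
  symm := ⟨fun _ _ h => h.symm⟩
  loopless := ⟨fun _ h => by simp at h⟩

theorem tree_isTree : tree.IsTree := by
  refine ⟨(connected_iff_exists_forall_reachable _).mpr ⟨[], fun z => ?_⟩, ?_⟩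
  · induction z with
    | nil => exact .rfl
    | cons m z ih => exact ih.trans (Adj.reachable (Or.inl ⟨m, rfl⟩))
  · have key : ∀ (m) (z : Node), ¬ (tree.deleteEdges {s(z, m :: z)}).Reachable (m :: z) z := by
      -- the nodes with suffix `m :: z` are closed under the remaining edges
      rintro m z ⟨p⟩
      have : ∀ {a b : Node} (p : (tree.deleteEdges {s(z, m :: z)}).Walk a b),
          m :: z <:+ a → m :: z <:+ b := by
        intro a b p
        induction p with
        | nil => exact id
        | cons h _ ih =>
          intro ha
          apply ih
          rw [deleteEdges_adj] at h
          obtain ⟨⟨m', rfl⟩ | ⟨m', rfl⟩, hne⟩ := h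
          · exact ha.trans (List.suffix_cons _ _)
          · rcases List.suffix_cons_iff.mp ha with he | hs
            · obtain ⟨rfl, rfl⟩ := List.cons.inj he
              exact absurd (by simp [Sym2.eq_swap]) hne
            · exact hs
      simpa using (this p List.suffix_rfl).length_le
    refine isAcyclic_iff_forall_adj_isBridge.mpr ?_
    rintro u v (⟨m, rfl⟩ | ⟨m, rfl⟩)
    · exact isBridge_iff.mpr fun h => key m u h.symm
    · rw [Sym2.eq_swap]
      exact isBridge_iff.mpr fun h => key m v h.symm

theorem tree_connected_of_vertex (v : Node) :
    (tree.induce {z : Node | v ∈ bag t z}).Connected := by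
  refine (connected_iff_exists_forall_reachable _).mpr ⟨⟨v, self_mem_bag v⟩, ?_⟩
  rintro ⟨z, hz⟩
  induction z with
  | nil =>
    obtain rfl : v = [] := by simpa [bag] using hz
    exact .rfl
  | cons m z ih =>
    by_cases hv : v = m :: z
    · subst hv
      exact .rfl
    · refine (ih (mem_bag_of_mem_bag_cons hz hv)).trans (Adj.reachable ?_)
      exact Or.inl ⟨m, rfl⟩

theorem treeWidth_graph_le : (graph t).treeWidth ≤ t := by
  let D : (graph t).TreeDecomposition :=
    { node := Node
      tree := tree
      isTree := tree_isTree
      bag := fun z => bag t z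
      exists_bag_of_adj := by
        rintro u v (h | h)
        · exact ⟨v, lower_subset_bag v h, self_mem_bag v⟩
        · exact ⟨u, self_mem_bag u, lower_subset_bag u h⟩
      connected_of_vertex := tree_connected_of_vertex }
  refine (iInf_le _ D).trans (iSup_le fun z => tsub_le_iff_right.mpr ?_)
  change (bag t z : Set Node).encard ≤ _
  rw [Set.encard_coe_eq_coe_finsetCard]
  exact_mod_cast card_bag_le z

/-- A clique of the universal graph is contained in the bag of its vertex of maximal level. -/
theorem exists_subset_bag {s : Finset Node} (hs : s.Nonempty) (hc : (graph t).IsClique s) :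
    ∃ v ∈ s, s ⊆ bag t v := by
  obtain ⟨v, hv, hmax⟩ := s.exists_max_image List.length hs
  refine ⟨v, hv, fun u hu => ?_⟩
  by_cases huv : u = v
  · exact huv ▸ self_mem_bag u
  · rcases hc hu hv huv with h | h
    · exact lower_subset_bag v h
    · exact absurd (length_lt_of_mem_lower h) (hmax u hu).not_gt

/-- The vertices whose bag does not contain a `k`-clique. -/
def good (t k : ℕ) : Set Node := {z | (graph t).CliqueFreeOn (bag t z) k}

theorem cliqueFreeOn_good (hk : 1 ≤ k) : (graph t).CliqueFreeOn (good t k) k := by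
  intro s hs hc
  obtain ⟨v, hv, hsub⟩ :=
    exists_subset_bag (card_pos.mp (by rw [hc.card_eq]; exact hk)) hc.isClique
  exact hs hv (by exact_mod_cast hsub) hc

/-- The parts of bags that consist of good vertices form an extension family. -/
theorem isExtensionFamily (hk : 1 ≤ k) :
    ((graph t).induce (good t k)).IsExtensionFamily t k
      {P | ∃ z, P.map (Function.Embedding.subtype _) ⊆ bag t z} where
  empty_mem := ⟨[], by simp⟩
  mono := fun P Q hPQ ⟨z, hz⟩ => ⟨z, (map_subset_map.mpr hPQ).trans hz⟩
  extend := by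
    rintro P ⟨z, hz⟩ hcard A hA hfree
    obtain ⟨m, hbag, hlower⟩ := exists_cons hz (by simpa using hcard) (map_subset_map.mpr hA)
    have hlen : ∀ u ∈ P, u.1.length < (m :: z).length := fun u hu => by
      have := (suffix_of_mem_bag (hz (mem_map_of_mem _ hu))).length_le
      simp only [Function.Embedding.subtype_apply] at this
      simp only [List.length_cons]
      omega
    have hgood : m :: z ∈ good t k := by
      intro s hs hc
      rw [hbag] at hs
      by_cases hm : m :: z ∈ s
      · -- the other vertices of the clique are a clique in `A`
        have hA' : s.erase (m :: z) ⊆ A.map (Function.Embedding.subtype _) := by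
          intro u hu
          obtain ⟨hne, hus⟩ := mem_erase.mp hu
          have huP := (mem_insert.mp (hs hus)).resolve_left hne
          obtain ⟨u', hu', rfl⟩ := mem_map.mp huP
          rw [← hlower]
          exact (adj_iff_of_length_lt (hlen u' hu')).mp (hc.isClique hus hm hne)
        obtain ⟨B, hB, hBs⟩ := subset_map_iff.mp hA'
        refine hfree (t := B) (by exact_mod_cast hB) ⟨?_, ?_⟩
        · intro a ha b hb hab
          have : ∀ c ∈ B, c.1 ∈ s := fun c hc' =>
            mem_of_mem_erase (hBs ▸ mem_map_of_mem (Function.Embedding.subtype _) hc')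
          exact hc.isClique (this a ha) (this b hb) (Subtype.coe_injective.ne hab)
        · rw [← card_map (Function.Embedding.subtype _), ← hBs, card_erase_of_mem hm, hc.card_eq]
      · refine cliqueFreeOn_good hk (fun u hu => ?_) hc
        obtain ⟨u', -, rfl⟩ :=
          mem_map.mp ((mem_insert.mp (hs hu)).resolve_left (ne_of_mem_of_not_mem hu hm))
        exact u'.2
    refine ⟨⟨m :: z, hgood⟩, fun hm => lt_irrefl _ (hlen _ hm), ⟨m :: z, ?_⟩, fun u hu => ?_⟩
    · rw [map_insert, hbag]
      rfl
    · rw [induce_adj, adj_comm, adj_iff_of_length_lt (hlen u hu), hlower]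
      simp

end Universal

/-! ### Finite clique-free graphs of given tree-width -/

theorem exists_cliqueFree_treeWidth_le_gBound_le (t k : ℕ) (hk : 2 ≤ k) :
    ∃ (V : Type) (_ : Fintype V) (G : SimpleGraph V),
      G.CliqueFree k ∧ G.treeWidth ≤ (t : ℕ∞) ∧ (gBound t k : ℕ∞) ≤ G.chromaticNumber := by
  classical
  let G := (Universal.graph t).induce (Universal.good t k)
  have hcol : ∀ n, G.Colorable n → gBound t k ≤ n := by
    rintro n ⟨C⟩
    have hPos := Universal.isExtensionFamily (t := t) (k := k) (by omega)
    obtain ⟨Q, -, hQC, hQ⟩ := hPos.exists_rainbow C hk (t := t) (r := 0) hPos.empty_mem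
      (by simp) (by simp) (by simp)
    refine hQ.trans ?_
    rw [← card_image_of_injOn hQC]
    exact (card_le_univ _).trans_eq (Fintype.card_fin n)
  have hpos : 1 ≤ gBound t k := by
    obtain ⟨k, rfl⟩ := Nat.exists_eq_add_of_le' hk
    rcases k with _ | k <;> rcases t with _ | t <;> simp [gBound, Nat.ceilDiv_eq_add_pred_div]
    omega
  obtain ⟨H, hfin, hH⟩ := exists_finite_subgraph_not_colorable (G := G) (n := gBound t k - 1)
    fun h => by have := hcol _ h; omega
  let f := Embedding.induce (G := Universal.graph t) (Universal.good t k)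
  refine ⟨H.verts, hfin.fintype, H.coe, ?_, ?_, ?_⟩
  · refine CliqueFree.comap ⟨⟨H.hom, H.hom_injective⟩⟩ ?_
    exact (cliqueFree_induce_iff ..).mpr (Universal.cliqueFreeOn_good (by omega))
  · refine (treeWidth_le_of_injective_hom H.hom H.hom_injective).trans ?_
    exact (treeWidth_le_of_injective_hom f.toHom f.injective).trans Universal.treeWidth_graph_le
  · refine le_chromaticNumber_iff_colorable.mpr fun n hn => ?_
    by_contra hlt
    exact hH (hn.mono (by have : n < gBound t k := by exact_mod_cast (not_le.mp hlt)
                          omega))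

end SimpleGraph

theorem theorem2 :
    (∀ t k : ℕ, 2 ≤ k →
      ∃ (V : Type) (_ : Fintype V) (G : SimpleGraph V),
        G.CliqueFree k ∧ G.treeWidth ≤ (t : ℕ∞) ∧ (gBound t k : ℕ∞) ≤ G.chromaticNumber) ∧
    (∀ t : ℕ, 1 ≤ t →
      ∃ (V : Type) (_ : Fintype V) (G : SimpleGraph V),
        G.CliqueFree 3 ∧ G.treeWidth ≤ (t : ℕ∞) ∧
          G.chromaticNumber = (((t + 3) ⌈/⌉ 2 : ℕ) : ℕ∞)) := by
  refine ⟨SimpleGraph.exists_cliqueFree_treeWidth_le_gBound_le, fun t ht => ?_⟩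
  obtain ⟨V, _, G, hfree, hw, hχ⟩ :=
    SimpleGraph.exists_cliqueFree_treeWidth_le_gBound_le t 3 (by norm_num)
  have hg : gBound t 3 = (t + 3) ⌈/⌉ 2 := by
    obtain ⟨t, rfl⟩ := Nat.exists_eq_add_of_le' ht
    simp only [gBound, Nat.ceilDiv_eq_add_pred_div]
    omega
  rw [hg] at hχ
  obtain ⟨s, hs⟩ := G.exists_induce_chromaticNumber_eq hχ
  classical
  let f := SimpleGraph.Embedding.induce (G := G) s
  exact ⟨s, inferInstance, G.induce s, hfree.comap ⟨f.toCopy⟩,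
    (SimpleGraph.treeWidth_le_of_injective_hom f.toHom f.injective).trans hw, hs⟩
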